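/- Let $n \ge 0$ and let $S_n$ be the symmetric group on $\{1,\dots,n\}$. For $\pi \in S_n$ let $\mathrm{des}(\pi)$ be the number of descents of $\pi$, that is, the number of $i \in \{1,\dots,n-1\}$ with $\pi(i) > \pi(i+1)$. Let $C$ be a conjugacy class of $S_n$ and let $M := \max_{\pi \in C} \mathrm{des}(\pi)$. If $C \ne \{e\}$, then $$\{\mathrm{des}(\pi) : \pi \in C\} = \{1, \dots, M\}.$$ If $C = \{e\}$, then $\{\mathrm{des}(\pi) : \pi \in C\} = \{0\}$. -/

import Mathlib

/-- The set of descents of a permutation `π` of an `n`-element chain. With positions counted from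
`0`, a position `i` is a descent if it is not the last one and `π i > π (i + 1)`. -/
def descentSet {n : ℕ} (π : Equiv.Perm (Fin n)) : Finset (Fin n) :=
  {i : Fin n | ∃ h : (i : ℕ) + 1 < n, π ⟨(i : ℕ) + 1, h⟩ < π i}

/-- The number of descents of a permutation. -/
def des {n : ℕ} (π : Equiv.Perm (Fin n)) : ℕ :=
  (descentSet π).card

/-!
Count descents cyclically: `cyclicDes π` is `des π`, plus one if `π 0 < π (last)`. The number of
cyclic descents is the number of times the word of `π` winds around the circle, so conjugating by a
rotation preserves it; the rotation that moves a position `i` to the end turns `π` into a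
permutation whose number of descents is `cyclicDes π` or one less, depending on `i`. Conjugating by
an adjacent transposition swaps two neighbouring positions and two neighbouring values, and each of
these swaps raises `cyclicDes` by at most one.

Suppose that `des π ≤ k ≤ des σ` for conjugate `π` and `σ`, that `1 ≤ k`, and that no conjugate has
`k` descents. If a conjugate had `k + 1` cyclic descents, then some rotation of it would have `k`
descents, unless its displacements `π i - i` increase weakly all the way around the circle; but then
it is a rotation, with a single cyclic descent. So `cyclicDes` can exceed `k` along a chain of
adjacent transpositions only by a jump from `k` to `k + 2`. Such a jump needs `i ≠ j` such that the
permutation sends `i, i + 1` to `j, j + 1`, and then moving `i` to the end gives `k` descents.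

For a conjugate with at most one descent, mark one point in each cycle of `π` and order the points
`x` by their itineraries, which record for each `t` whether `π ^ t` sends `x` to a marked point. The
shift preserves the lexicographic order of sequences with the same first letter, so, for this order,
`π` is increasing on the marked points and on the unmarked ones.
-/

open Equiv

section Descents

variable {n : ℕ}

theorem castSucc_mem_descentSet {π : Perm (Fin (n + 1))} {i : Fin n} :
    i.castSucc ∈ descentSet π ↔ π i.succ < π i.castSucc := by
  simp [descentSet, Fin.succ]

theorem last_notMem_descentSet (π : Perm (Fin (n + 1))) : Fin.last n ∉ descentSet π := by
  simp [descentSet]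

theorem des_one : des (1 : Perm (Fin n)) = 0 := by
  simp [des, descentSet, Fin.lt_def]

theorem des_pos {π : Perm (Fin n)} (hπ : π ≠ 1) : 0 < des π := by
  contrapose! hπ
  obtain _ | n := n
  · exact Subsingleton.elim _ _
  have hempty : descentSet π = ∅ := Finset.card_eq_zero.1 (Nat.le_zero.1 hπ)
  refine (Perm.monotone_iff π).1 (Fin.monotone_iff_le_succ.2 fun i => not_lt.1 fun hlt => ?_)
  exact Finset.notMem_empty _ (hempty ▸ castSucc_mem_descentSet.2 hlt)

theorem des_le_one_of_strictMonoOn {τ : Perm (Fin n)} {s : Set (Fin n)}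
    (hs : IsUpperSet s) (hτ : StrictMonoOn τ s) (hτ' : StrictMonoOn τ sᶜ) : des τ ≤ 1 := by
  have hcross {i : Fin n} (hi : i ∈ descentSet τ) :
      i ∉ s ∧ ∃ h : (i : ℕ) + 1 < n, (⟨i + 1, h⟩ : Fin n) ∈ s := by
    obtain ⟨h, hlt⟩ : ∃ h : (i : ℕ) + 1 < n, τ ⟨i + 1, h⟩ < τ i := by simpa [descentSet] using hi
    have hsucc : i < ⟨i + 1, h⟩ := Fin.lt_def.2 (Nat.lt_succ_self i)
    have his : i ∉ s := fun his => hlt.not_gt (hτ his (hs hsucc.le his) hsucc)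
    exact ⟨his, h, by_contra fun hsucc' => hlt.not_gt (hτ' his hsucc' hsucc)⟩
  refine Finset.card_le_one.2 fun i hi j hj => ?_
  obtain ⟨his, hi', hsucci⟩ := hcross hi
  obtain ⟨hjs, hj', hsuccj⟩ := hcross hj
  exact le_antisymm (not_lt.1 fun hji => his (hs (Fin.le_def.2 (Nat.succ_le_of_lt hji)) hsuccj))
    (not_lt.1 fun hij => hjs (hs (Fin.le_def.2 (Nat.succ_le_of_lt hij)) hsucci))

theorem exists_isConj_des_le_one_of_key {α : Type*} [LinearOrder α] {π : Perm (Fin n)}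
    {key : Fin n → α} (hkey : key.Injective) {s : Set (Fin n)}
    (hs : ∀ x y, key x < key y → x ∈ s → y ∈ s)
    (hmono : ∀ x y, key x < key y → (x ∈ s ↔ y ∈ s) → key (π x) < key (π y)) :
    ∃ τ, IsConj π τ ∧ des τ ≤ 1 := by
  set e := Tuple.sort key
  have he : StrictMono (key ∘ e) :=
    (Tuple.monotone_sort key).strictMono_of_injective (hkey.comp e.injective)
  have hτ {i j : Fin n} (hij : i < j) (hiff : e i ∈ s ↔ e j ∈ s) :
      (e⁻¹ * π * e) i < (e⁻¹ * π * e) j := by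
    rw [← he.lt_iff_lt]
    simpa using hmono _ _ (he hij) hiff
  refine ⟨e⁻¹ * π * e, isConj_iff.2 ⟨e⁻¹, by rw [inv_inv]⟩,
    des_le_one_of_strictMonoOn (s := e ⁻¹' s) ?_ ?_ ?_⟩
  · intro i j hij hi
    obtain rfl | hij := hij.eq_or_lt
    exacts [hi, hs _ _ (he hij) hi]
  · exact fun i hi j hj hij => hτ hij (iff_of_true hi hj)
  · exact fun i hi j hj hij => hτ hij (iff_of_false hi hj)

end Descents

section CyclicDescents

variable {n : ℕ} {α : Type*} [LinearOrder α]

/-- The set of cyclic descents of a word: the last position counts as well, and the letter that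
follows it is the first one. The encoding uses that `i + 1` wraps around in `Fin (n + 1)`. -/
def cyclicDescentSet (w : Fin (n + 1) → α) : Finset (Fin (n + 1)) :=
  {i | w (i + 1) < w i}

/-- The number of cyclic descents of a word. -/
def cyclicDes (w : Fin (n + 1) → α) : ℕ :=
  (cyclicDescentSet w).card

theorem mem_cyclicDescentSet {w : Fin (n + 1) → α} {i : Fin (n + 1)} :
    i ∈ cyclicDescentSet w ↔ w (i + 1) < w i := by
  simp [cyclicDescentSet]

theorem cyclicDes_eq_des_add (π : Perm (Fin (n + 1))) :
    cyclicDes π = des π + if π 0 < π (Fin.last n) then 1 else 0 := by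
  have hset : cyclicDescentSet π =
      if π 0 < π (Fin.last n) then insert (Fin.last n) (descentSet π) else descentSet π := by
    ext i
    induction i using Fin.lastCases with
    | last => split_ifs <;> simp_all [mem_cyclicDescentSet, last_notMem_descentSet]
    | cast i =>
      split_ifs <;> simp [mem_cyclicDescentSet, castSucc_mem_descentSet, i.castSucc_ne_last]
  rw [cyclicDes, des, hset]
  split_ifs
  · exact Finset.card_insert_of_notMem (last_notMem_descentSet π)
  · rfl

-- Each step `w i → w (i + 1)` is a forward step on the circle, which passes the origin exactly at a
-- cyclic descent; so the number of cyclic descents is the number of times `w` winds around.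
theorem sum_val_sub_eq_mul_cyclicDes {m : ℕ} (w : Fin (m + 1) → Fin (n + 1)) :
    ∑ i, (w (i + 1) - w i : Fin (n + 1)).val = (n + 1) * cyclicDes w := by
  have hstep (i : Fin (m + 1)) : (w (i + 1) - w i : Fin (n + 1)).val + (w i).val =
      (w (i + 1)).val + if w (i + 1) < w i then n + 1 else 0 := by
    split_ifs with h
    · rw [Fin.coe_sub_iff_lt.2 h]
      omega
    · rw [Fin.coe_sub_iff_le.2 (not_lt.1 h), add_zero, Nat.sub_add_cancel (not_lt.1 h)]
  have hshift : ∑ i, (w (i + 1)).val = ∑ i, (w i).val :=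
    Equiv.sum_comp (Equiv.addRight 1) fun i => (w i).val
  have hsum := Finset.sum_congr (s₁ := Finset.univ) rfl fun i _ => hstep i
  rw [Finset.sum_add_distrib, Finset.sum_add_distrib, hshift, add_comm, add_left_cancel_iff] at hsum
  rw [hsum, ← Finset.sum_filter, Finset.sum_const, smul_eq_mul, mul_comm, cyclicDes,
    cyclicDescentSet]

theorem cyclicDes_addRight_conj (k : Fin (n + 1)) (π : Perm (Fin (n + 1))) :
    cyclicDes (Equiv.addRight k * π * (Equiv.addRight k)⁻¹) = cyclicDes π := by
  apply Nat.eq_of_mul_eq_mul_left n.succ_pos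
  rw [Nat.succ_eq_add_one, ← sum_val_sub_eq_mul_cyclicDes, ← sum_val_sub_eq_mul_cyclicDes,
    ← Equiv.sum_comp (Equiv.addRight k)]
  simp [add_right_comm _ k]

theorem cyclicDescentSet_comp_swap_subset_of_le {w : Fin (n + 1) → α} {j : Fin (n + 1)}
    (h : w j ≤ w (j + 1)) :
    cyclicDescentSet (w ∘ swap j (j + 1)) ⊆ insert j (cyclicDescentSet w) := by
  have hge (i) (hi : i ≠ j + 1) : w i ≤ (w ∘ swap j (j + 1)) i := by
    rw [Function.comp_apply, swap_apply_def]
    split_ifs with hj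
    exacts [hj ▸ h, le_rfl]
  have hle (i) (hi : i ≠ j) : (w ∘ swap j (j + 1)) i ≤ w i := by
    rw [Function.comp_apply, swap_apply_def, if_neg hi]
    split_ifs with hj
    exacts [hj ▸ h, le_rfl]
  intro i hi
  rw [Finset.mem_insert, or_iff_not_imp_left]
  intro hij
  rw [mem_cyclicDescentSet] at hi ⊢
  exact (hge _ (by simpa using hij)).trans_lt (hi.trans_le (hle _ hij))

theorem cyclicDescentSet_comp_swap_subset_of_lt {w : Fin (n + 1) → α} {j : Fin (n + 1)}
    (h : w (j + 1) < w j) :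
    cyclicDescentSet (w ∘ swap j (j + 1)) ⊆
      insert (j - 1) (insert (j + 1) ((cyclicDescentSet w).erase j)) := by
  intro i hi
  simp only [Finset.mem_insert, Finset.mem_erase, or_iff_not_imp_left]
  intro hpred hsucc
  rw [mem_cyclicDescentSet, Function.comp_apply, Function.comp_apply] at hi
  have hij : i ≠ j := by
    rintro rfl
    rw [swap_apply_left, swap_apply_right] at hi
    exact hi.not_gt h
  rw [swap_apply_of_ne_of_ne hij hsucc,
    swap_apply_of_ne_of_ne (fun h => hpred (eq_sub_of_add_eq h)) (by simpa using hij)] at hi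
  exact ⟨hij, mem_cyclicDescentSet.2 hi⟩

theorem cyclicDes_comp_swap_le (w : Fin (n + 1) → α) (j : Fin (n + 1)) :
    cyclicDes (w ∘ swap j (j + 1)) ≤ cyclicDes w + 1 := by
  rcases le_or_gt (w j) (w (j + 1)) with h | h
  · exact (Finset.card_le_card (cyclicDescentSet_comp_swap_subset_of_le h)).trans
      (Finset.card_insert_le _ _)
  · calc cyclicDes (w ∘ swap j (j + 1))
        ≤ ((cyclicDescentSet w).erase j).card + 1 + 1 :=
          (Finset.card_le_card (cyclicDescentSet_comp_swap_subset_of_lt h)).trans <|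
            (Finset.card_insert_le _ _).trans <|
              Nat.add_le_add_right (Finset.card_insert_le _ _) 1
      _ = cyclicDes w + 1 := by
          rw [Finset.card_erase_add_one (mem_cyclicDescentSet.2 h), cyclicDes]

theorem eq_and_eq_of_swap_lt_swap {x y a b : α} (hxy : x ⋖ y) (hab : a ≤ b)
    (hswap : swap x y b < swap x y a) : a = x ∧ b = y := by
  have hlt := hxy.lt
  have hgap_a : x < a → y ≤ a := hxy.ge_of_gt
  have hgap_b : x < b → y ≤ b := hxy.ge_of_gt
  simp only [swap_apply_def] at hswap
  grind

theorem cyclicDes_swap_comp_le_of_forall {w : Fin (n + 1) → α} {x y : α} (hxy : x ⋖ y)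
    (h : ∀ i, w i = x → w (i + 1) ≠ y) : cyclicDes (swap x y ∘ w) ≤ cyclicDes w := by
  refine Finset.card_le_card fun i hi => ?_
  by_contra hi'
  rw [mem_cyclicDescentSet] at hi hi'
  obtain ⟨h₁, h₂⟩ := eq_and_eq_of_swap_lt_swap hxy (not_lt.1 hi') hi
  exact h i h₁ h₂

theorem cyclicDes_swap_comp_le {w : Fin (n + 1) → α} (hw : w.Injective) {x y : α} (hxy : x ⋖ y) :
    cyclicDes (swap x y ∘ w) ≤ cyclicDes w + 1 := by
  by_cases h : ∃ i, w i = x ∧ w (i + 1) = y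
  · obtain ⟨i, rfl, -⟩ := h
    refine (Finset.card_le_card fun k hk => ?_).trans (Finset.card_insert_le i _)
    rw [Finset.mem_insert, or_iff_not_imp_right]
    intro hk'
    rw [mem_cyclicDescentSet] at hk hk'
    exact hw (eq_and_eq_of_swap_lt_swap hxy (not_lt.1 hk') hk).1
  · push Not at h
    exact (cyclicDes_swap_comp_le_of_forall hxy h).trans (Nat.le_succ _)

end CyclicDescents

section Rotation

variable {n : ℕ} {π : Perm (Fin (n + 1))}

-- Conjugate by the rotation that moves position `i` to the end; subtraction is modulo `n + 1`.
theorem exists_isConj_cyclicDes_eq_des_add (π : Perm (Fin (n + 1))) (i : Fin (n + 1)) :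
    ∃ τ, IsConj π τ ∧
      cyclicDes π = des τ + if π (i + 1) - (i + 1) < π i - i - 1 then 1 else 0 := by
  refine ⟨_, isConj_iff.2 ⟨Equiv.addRight (-(i + 1)), rfl⟩, ?_⟩
  have hlast : Fin.last n + (i + 1) = i := by
    rw [add_comm i, ← add_assoc, Fin.last_add_one, zero_add]
  rw [← cyclicDes_addRight_conj (-(i + 1)), cyclicDes_eq_des_add, sub_sub (π i)]
  simp [hlast, sub_eq_add_neg (_ : Fin (n + 1)) (i + 1), -neg_add_rev]

theorem exists_isConj_des_add_one_eq_cyclicDes (hπ : 2 ≤ cyclicDes π) :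
    ∃ τ, IsConj π τ ∧ des τ + 1 = cyclicDes π := by
  by_contra! hno
  have hmono (i : Fin (n + 1)) : π i - i ≤ π (i + 1) - (i + 1) := by
    obtain ⟨τ, hτ, h⟩ := exists_isConj_cyclicDes_eq_des_add π i
    have hle : π i - i - 1 ≤ π (i + 1) - (i + 1) := by
      by_contra! hlt
      exact hno τ hτ (by rw [h, if_pos hlt])
    by_contra! hlt
    have heq : π i - i - 1 = π (i + 1) - (i + 1) := by
      refine le_antisymm hle (Fin.le_def.2 ?_)
      rw [Fin.val_sub_one_of_ne_zero (ne_bot_of_gt hlt)]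
      exact Nat.le_sub_one_of_lt hlt
    rw [sub_sub, sub_left_inj] at heq
    rw [← π.injective heq] at hlt
    exact hlt.false
  have hconst : ∀ i, π i - i = π (i + 1) - (i + 1) := by
    have := (Finset.sum_eq_sum_iff_of_le fun i _ => Fin.le_def.1 (hmono i)).1
      (Equiv.sum_comp (Equiv.addRight (1 : Fin (n + 1))) fun i => (π i - i).val).symm
    exact fun i => Fin.ext (this i (Finset.mem_univ i))
  have hstep (i : Fin (n + 1)) : π (i + 1) - π i = 1 := by
    rw [sub_eq_sub_iff_sub_eq_sub.1 (hconst i).symm, add_sub_cancel_left]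
  have hsum := sum_val_sub_eq_mul_cyclicDes π
  simp only [hstep, Finset.sum_const, Finset.card_univ, Fintype.card_fin, smul_eq_mul] at hsum
  rw [← Nat.eq_of_mul_eq_mul_left n.succ_pos hsum, Fin.val_one'] at hπ
  exact (Nat.mod_le 1 (n + 1)).not_gt hπ

theorem exists_isConj_des_eq_cyclicDes_of_apply_eq {i j : Fin (n + 1)} (hij : i ≠ j) (hi : π i = j)
    (hi' : π (i + 1) = j + 1) : ∃ τ, IsConj π τ ∧ des τ = cyclicDes π := by
  obtain ⟨τ, hτ, h⟩ := exists_isConj_cyclicDes_eq_des_add π i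
  refine ⟨τ, hτ, ?_⟩
  rw [hi, hi', add_sub_add_right_eq_sub, if_neg, add_zero] at h
  · exact h.symm
  · exact (Fin.sub_one_lt_iff.2 (Fin.pos_iff_ne_zero.2 (sub_ne_zero.2 hij.symm))).not_gt

theorem cyclicDes_swap_conj_le_or (π : Perm (Fin (n + 1))) (j : Fin n) :
    cyclicDes (swap j.castSucc j.succ * π * (swap j.castSucc j.succ)⁻¹) ≤ cyclicDes π + 1 ∨
      cyclicDes (swap j.castSucc j.succ * π * (swap j.castSucc j.succ)⁻¹) ≤ cyclicDes π + 2 ∧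
        ∃ τ, IsConj π τ ∧ des τ = cyclicDes π := by
  have hcov : j.castSucc ⋖ j.succ := Fin.covBy_iff.2 (Order.covBy_add_one _)
  have hpos : cyclicDes (swap j.castSucc j.succ * π * (swap j.castSucc j.succ)⁻¹) ≤
      cyclicDes (swap j.castSucc j.succ ∘ π) + 1 := by
    rw [swap_inv, ← Fin.coeSucc_eq_succ]
    exact cyclicDes_comp_swap_le (swap j.castSucc (j.castSucc + 1) ∘ π) _
  by_cases hadj : ∃ i, π i = j.castSucc ∧ π (i + 1) = j.succ
  · obtain ⟨i, hi, hi'⟩ := hadj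
    obtain rfl | hij := eq_or_ne i j.castSucc
    · left
      rw [Fin.coeSucc_eq_succ] at hi'
      have hcomm : swap j.castSucc j.succ * π = π * swap j.castSucc j.succ := by
        rw [mul_swap_eq_swap_mul, hi, hi']
      rw [hcomm, mul_inv_cancel_right]
      exact Nat.le_succ _
    · rw [← Fin.coeSucc_eq_succ] at hi'
      exact .inr ⟨hpos.trans (Nat.add_le_add_right (cyclicDes_swap_comp_le π.injective hcov) 1),
        exists_isConj_des_eq_cyclicDes_of_apply_eq hij hi hi'⟩
  · push Not at hadj
    exact .inl (hpos.trans (Nat.add_le_add_right (cyclicDes_swap_comp_le_of_forall hcov hadj) 1))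

theorem cyclicDes_ne_succ_of_forall_des_ne {k : ℕ} (hk : 1 ≤ k)
    (hno : ∀ τ, IsConj π τ → des τ ≠ k) : cyclicDes π ≠ k + 1 := by
  intro h
  obtain ⟨τ, hτ, h'⟩ := exists_isConj_des_add_one_eq_cyclicDes (π := π) (by omega)
  exact hno τ hτ (Nat.succ_injective (h'.trans h))

theorem cyclicDes_le_of_isConj_of_forall_des_ne {ρ : Perm (Fin (n + 1))} {k : ℕ} (hk : 1 ≤ k)
    (hno : ∀ τ, IsConj π τ → des τ ≠ k) (hπ : cyclicDes π ≤ k) (hρ : IsConj π ρ) :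
    cyclicDes ρ ≤ k := by
  obtain ⟨g, rfl⟩ := isConj_iff.1 hρ
  clear hρ
  have hg : g ∈ Submonoid.closure (Set.range fun j : Fin n => swap j.castSucc j.succ) := by
    rw [Perm.mclosure_swap_castSucc_succ]
    exact Submonoid.mem_top g
  induction hg using Submonoid.closure_induction_left with
  | one => rwa [one_mul, inv_one, mul_one]
  | mul_left s hs g _ ih =>
    obtain ⟨j, rfl⟩ := hs
    have hconj : IsConj π (g * π * g⁻¹) := isConj_iff.2 ⟨g, rfl⟩
    rw [mul_inv_rev, ← mul_assoc, mul_assoc _ g, mul_assoc _ (g * π)]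
    generalize g * π * g⁻¹ = ρ at hconj ih
    have hne := cyclicDes_ne_succ_of_forall_des_ne hk fun τ hτ =>
      hno τ ((hconj.trans (isConj_iff.2 ⟨swap j.castSucc j.succ, rfl⟩)).trans hτ)
    rcases cyclicDes_swap_conj_le_or ρ j with h | ⟨h, τ, hτ, hdes⟩
    · exact Nat.le_of_lt_succ ((h.trans (Nat.succ_le_succ ih)).lt_of_ne hne)
    · have hlt := ih.lt_of_ne fun heq => hno τ (hconj.trans hτ) (hdes.trans heq)
      exact Nat.le_of_lt_succ ((h.trans (Nat.succ_le_succ hlt)).lt_of_ne hne)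

end Rotation

theorem exists_isConj_des_eq {n : ℕ} {π σ : Perm (Fin n)} (hπσ : IsConj π σ) {k : ℕ} (hk : 1 ≤ k)
    (hπ : des π ≤ k) (hσ : k ≤ des σ) : ∃ τ, IsConj π τ ∧ des τ = k := by
  obtain _ | n := n
  · exact ⟨π, .refl π, le_antisymm hπ (Subsingleton.elim σ π ▸ hσ)⟩
  by_contra! hno
  have hcycπ : cyclicDes π ≤ k := by
    have := cyclicDes_ne_succ_of_forall_des_ne hk hno
    have := cyclicDes_eq_des_add π
    split_ifs at this <;> omega
  have hcycσ := cyclicDes_le_of_isConj_of_forall_des_ne hk hno hcycπ hπσ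
  have := cyclicDes_eq_des_add σ
  exact hno σ hπσ (by omega)

section Itineraries

/-- A marked point in each cycle of `π`, namely the one in the cycle of `x`; the choice is
arbitrary. -/
noncomputable def cycleRep {α : Type*} (π : Perm α) (x : α) : α :=
  (Quotient.mk (Perm.SameCycle.setoid π) x).out

theorem cycleRep_apply {α : Type*} (π : Perm α) (x : α) : cycleRep π (π x) = cycleRep π x :=
  congrArg Quotient.out (Quotient.sound (s := Perm.SameCycle.setoid π)
    (Perm.sameCycle_apply_left.2 (.refl π x)))

theorem exists_pow_apply_eq_cycleRep {α : Type*} [Finite α] (π : Perm α) (x : α) :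
    ∃ t : ℕ, (π ^ t) x = cycleRep π x := by
  have : Perm.SameCycle π (cycleRep π x) x := Quotient.mk_out (s := Perm.SameCycle.setoid π) x
  exact this.symm.exists_nat_pow_eq

/-- The itinerary of `x` under `π`: the sequence recording at which times `t` the orbit of `x`
visits the marked point of its cycle. -/
def itinerary {α : Type*} (π : Perm α) (x : α) : ℕ → Prop :=
  fun t => (π ^ t) x = cycleRep π x

theorem itinerary_apply {α : Type*} (π : Perm α) (x : α) :
    itinerary π (π x) = fun t => itinerary π x (t + 1) := by
  funext t
  rw [itinerary, itinerary, cycleRep_apply, ← Perm.mul_apply, ← pow_succ]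

/-- The sorting key of `x`: its itinerary, compared lexicographically with `False < True`, and then
the marked point of its cycle, to separate points of different cycles with equal itineraries. -/
noncomputable def itineraryKey {α : Type*} (π : Perm α) (x : α) : Lex (ℕ → Prop) ×ₗ α :=
  toLex (toLex (itinerary π x), cycleRep π x)

theorem itineraryKey_injective {α : Type*} [Finite α] (π : Perm α) :
    (itineraryKey π).Injective := by
  intro x y hxy
  obtain ⟨hit, hrep⟩ := Prod.ext_iff.1 (toLex_inj.1 hxy)
  obtain ⟨t, hx⟩ := exists_pow_apply_eq_cycleRep π x
  have hy : (π ^ t) y = cycleRep π y := (congrFun (toLex_inj.1 hit) t).mp hx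
  exact (π ^ t).injective (hx.trans (hrep.trans hy.symm))

theorem toLex_shift_lt_toLex_shift {β : Type*} [Preorder β] {u v : ℕ → β}
    (h₀ : u 0 = v 0) (h : toLex u < toLex v) :
    toLex (fun t => u (t + 1)) < toLex (fun t => v (t + 1)) := by
  obtain ⟨i, heq, hlt⟩ := h
  obtain _ | i := i
  · exact absurd h₀ hlt.ne
  · exact ⟨i, fun j hj => heq (j + 1) (Nat.succ_lt_succ hj), hlt⟩

theorem apply_eq_cycleRep_of_itineraryKey_lt {α : Type*} [LinearOrder α] {π : Perm α} {x y : α}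
    (h : itineraryKey π x < itineraryKey π y) (hx : x = cycleRep π x) : y = cycleRep π y :=
  Pi.apply_le_of_toLex (Prod.Lex.monotone_fst _ _ h.le)
    (fun j hj => absurd hj j.not_lt_zero) hx

theorem itineraryKey_apply_lt {α : Type*} [LinearOrder α] {π : Perm α} {x y : α}
    (h : itineraryKey π x < itineraryKey π y) (hxy : x = cycleRep π x ↔ y = cycleRep π y) :
    itineraryKey π (π x) < itineraryKey π (π y) := by
  simp only [itineraryKey, Prod.Lex.toLex_lt_toLex, itinerary_apply, cycleRep_apply] at h ⊢
  obtain hlt | ⟨heq, hlt⟩ := h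
  · exact .inl (toLex_shift_lt_toLex_shift (propext hxy) hlt)
  · exact .inr ⟨by rw [toLex_inj.1 heq], hlt⟩

end Itineraries

theorem exists_isConj_des_le_one {n : ℕ} (π : Perm (Fin n)) : ∃ τ, IsConj π τ ∧ des τ ≤ 1 :=
  exists_isConj_des_le_one_of_key (itineraryKey_injective π) (s := {x | x = cycleRep π x})
    (fun _ _ => apply_eq_cycleRep_of_itineraryKey_lt) fun _ _ => itineraryKey_apply_lt

theorem theorem2 (n : ℕ) (C : ConjClasses (Equiv.Perm (Fin n))) :
    ∃ M : ℕ, IsGreatest {k : ℕ | ∃ π ∈ C.carrier, des π = k} M ∧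
      (C.carrier ≠ {1} → {k : ℕ | ∃ π ∈ C.carrier, des π = k} = Set.Icc 1 M) ∧
      (C.carrier = {1} → {k : ℕ | ∃ π ∈ C.carrier, des π = k} = {0}) := by
  obtain ⟨π, rfl⟩ := C.exists_rep
  obtain ⟨σ, hσ, hmax⟩ := Set.exists_max_image (ConjClasses.mk π).carrier des (Set.toFinite _)
    ⟨π, ConjClasses.mem_carrier_mk⟩
  have hmem (τ : Perm (Fin n)) : τ ∈ (ConjClasses.mk π).carrier ↔ IsConj π τ := .rfl
  refine ⟨des σ, ⟨⟨σ, hσ, rfl⟩, ?_⟩, fun hne => ?_, fun heq => ?_⟩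
  · rintro _ ⟨τ, hτ, rfl⟩
    exact hmax τ hτ
  · ext k
    constructor
    · rintro ⟨τ, hτ, rfl⟩
      refine ⟨des_pos ?_, hmax τ hτ⟩
      rintro rfl
      obtain rfl := isConj_one_left.1 ((hmem _).1 hτ)
      exact hne (Set.ext fun ρ => (hmem ρ).trans isConj_one_right)
    · rintro ⟨hk, hkσ⟩
      obtain ⟨ρ, hρ, hdes⟩ := exists_isConj_des_le_one π
      obtain ⟨τ, hτ, rfl⟩ :=
        exists_isConj_des_eq (hρ.symm.trans ((hmem σ).1 hσ)) hk (hdes.trans hk) hkσ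
      exact ⟨τ, (hmem τ).2 (hρ.trans hτ), rfl⟩
  · simp [heq, des_one, eq_comm]
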